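/- Let $k$ be any field, let $R=k[\![t^3,t^4,t^5]\!]$ (the power series in $k[\![t]\!]$ supported in the numerical semigroup generated by $3,4,5$), and put $x=t^3$, $y=t^4$, $z=t^5$, $I=(x,y)\subseteq R$. Let $$A=\begin{pmatrix} y & z & x^2\\ -x & -y & -z\\ z & x^2 & xy\end{pmatrix},\qquad M=\operatorname{coker}(A)=R^{3}/\operatorname{im}A ,$$ and let $\bar e_1,\bar e_2,\bar e_3\in M$ be the classes of the standard basis vectors. Write $E=\operatorname{End}_R(M)$. Then: 1. $I$ is a canonical ideal of $R$: $I\ne 0$ and $I:(I:J)=J$ for every nonzero fractional ideal $J$ of $R$ (colons taken in the fraction field). 2. There is an exact sequence $0\to R\xrightarrow{s}M\xrightarrow{t}I\to 0$ with $s(1)=\bar e_3$, $t(\bar e_1)=x$, $t(\bar e_2)=y$, $t(\bar e_3)=0$, and it does not split. 3. $M$ is torsion-free, has rank $2$ (that is, $\dim_Q (Q\otimes_R M)=2$ for $Q$ the fraction field of $R$), is minimally generated by $3$ elements, and is indecomposable. 4. $M\otimes_R M$ is torsion-free. 5. $M$ is strongly self dual with respect to $I$: there is an $R$-isomorphism $\alpha:M\to\operatorname{Hom}_R(M,I)$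 with $\alpha(u)(v)=\alpha(v)(u)$ for all $u,v\in M$, namely one whose values $\alpha(\bar e_i)(\bar e_j)$ are the entries of $$\begin{pmatrix} -y & 0 & x\\ 0 & x^2 & y\\ x & y & 0\end{pmatrix}.$$ 6. Let $f\mapsto f^*$ be the $R$-linear involutive anti-automorphism of $E$ with $\alpha(f^*(u))=\alpha(u)\circ f$ for all $u\in M$, and let $M_*$ be $M$ regarded as a right $E$-module through $u\cdot f=f^*(u)$. Then $M$ is a cyclic left $E$-module and $M_*$ is a cyclic right $E$-module, both generated by $\bar e_3$; nevertheless $\bar e_3\otimes\bar e_3$ is a nonzero torsion element of the $R$-module $M_*\otimes_{E}M$, i.e. it is nonzero and is killed by a nonzerodivisor of $R$. -/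

import Mathlib

open scoped TensorProduct nonZeroDivisors PowerSeries

noncomputable section

/-! ### Algebras with involution, strong self duality, tensor products over an algebra -/

/-- An `R^*`-algebra structure on a (possibly noncommutative) `R`-algebra `E`: an `R`-linear ring
involution `E → Eᵒᵖ`. -/
structure RStarAlgebra (R E : Type*) [CommRing R] [Ring E] [Algebra R E] where
  star : E →ₗ[R] E
  star_mul : ∀ a b, star (a * b) = star b * star a
  star_one : star 1 = 1
  star_star : ∀ a, star (star a) = a

/-- `M_*`: the left `E`-module `M` seen as a right `E`-module through `x · f = f^* x`. Right
`E`-modules are modules over `Eᵐᵒᵖ`. -/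
def RStarAlgebra.RightModule {R E : Type*} [CommRing R] [Ring E] [Algebra R E]
    (_σ : RStarAlgebra R E) (M : Type*) : Type _ := M

namespace RStarAlgebra

variable {R E : Type*} [CommRing R] [Ring E] [Algebra R E] (σ : RStarAlgebra R E)
variable (M : Type*) [AddCommGroup M] [Module R M] [Module E M]

instance : AddCommGroup (σ.RightModule M) := inferInstanceAs (AddCommGroup M)

instance : Module R (σ.RightModule M) := inferInstanceAs (Module R M)

/-- The identity map from `M` to `M_*`. -/
def toRight : M ≃ₗ[R] σ.RightModule M := LinearEquiv.refl R M

instance : Module Eᵐᵒᵖ (σ.RightModule M) where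
  smul f x := σ.toRight M (σ.star f.unop • (σ.toRight M).symm x)
  one_smul x := by
    change σ.star 1 • (show M from x) = _
    rw [σ.star_one, one_smul]
  mul_smul f g x := by
    change σ.star (g.unop * f.unop) • (show M from x) =
      σ.star f.unop • (σ.star g.unop • (show M from x))
    rw [σ.star_mul, mul_smul]
  smul_zero f := smul_zero (A := M) (σ.star f.unop)
  smul_add f x y := smul_add (A := M) (σ.star f.unop) x y
  add_smul f g x := by
    change σ.star (f.unop + g.unop) • (show M from x) =
      σ.star f.unop • (show M from x) + σ.star g.unop • (show M from x)
    rw [map_add, add_smul]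
  zero_smul x := by
    change σ.star 0 • (show M from x) = (0 : M)
    rw [map_zero, zero_smul]

end RStarAlgebra

section TensorOver

variable (R E : Type*) [CommRing R] [Ring E] [Algebra R E]
variable (N M : Type*) [AddCommGroup N] [Module R N] [Module Eᵐᵒᵖ N]
variable [AddCommGroup M] [Module R M] [Module E M]

/-- The tensor product `N ⊗_E M` of a right `E`-module `N` and a left `E`-module `M` over an
`R`-algebra `E`, as an `R`-module: the quotient of `N ⊗_R M` by the relations
`(n · f) ⊗ m = n ⊗ (f · m)`. -/
abbrev TensorOver : Type _ :=
  (N ⊗[R] M) ⧸ Submodule.span R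
    {w : N ⊗[R] M | ∃ (f : E) (n : N) (m : M),
      w = (MulOpposite.op f • n) ⊗ₜ[R] m - n ⊗ₜ[R] (f • m)}

variable {N M}

/-- The class of a pure tensor in `N ⊗_E M`. -/
def TensorOver.tmul (n : N) (m : M) : TensorOver R E N M :=
  Submodule.Quotient.mk (n ⊗ₜ[R] m)

end TensorOver

/-- A strong self duality of `M` with respect to `N`: an isomorphism `α : M → Hom_R(M, N)` with
`α(x)(y) = α(y)(x)`. The module `M` is strongly self dual with respect to `N` if there is one. -/
structure StrongSelfDuality (R M N : Type*) [CommRing R] [AddCommGroup M] [Module R M]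
    [AddCommGroup N] [Module R N] where
  toEquiv : M ≃ₗ[R] (M →ₗ[R] N)
  comm : ∀ x y, toEquiv x y = toEquiv y x

/-- The `R^*`-algebra structure `f^* = α⁻¹ ∘ Hom_R(f, N) ∘ α` on `End_R(M)` given by a strong self
duality `α`. -/
def StrongSelfDuality.rStarAlgebra {R M N : Type*} [CommRing R] [AddCommGroup M] [Module R M]
    [AddCommGroup N] [Module R N] (α : StrongSelfDuality R M N) :
    RStarAlgebra R (Module.End R M) where
  star :=
    { toFun := fun f => α.toEquiv.symm.toLinearMap ∘ₗ LinearMap.lcomp R N f ∘ₗ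
        α.toEquiv.toLinearMap
      map_add' := fun f g => by
        ext x
        apply α.toEquiv.injective
        ext y
        simp
      map_smul' := fun r f => by
        ext x
        apply α.toEquiv.injective
        ext y
        simp }
  star_mul f g := by
    ext x
    apply α.toEquiv.injective
    ext y
    simp
  star_one := by
    ext x
    apply α.toEquiv.injective
    ext y
    simp
  star_star f := by
    ext x
    apply α.toEquiv.injective
    ext y
    simp only [LinearMap.coe_mk, AddHom.coe_mk, LinearMap.coe_comp, LinearEquiv.coe_coe,
      Function.comp_apply, LinearEquiv.apply_symm_apply, LinearMap.lcomp_apply]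
    rw [α.comm]
    simp only [LinearEquiv.apply_symm_apply, LinearMap.lcomp_apply]
    rw [α.comm]

/-! ### Module-theoretic notions -/

/-- A module is indecomposable if it is nonzero and is not the direct sum of two nonzero
submodules. -/
def IsIndecomposableModule (R M : Type*) [CommRing R] [AddCommGroup M] [Module R M] : Prop :=
  Nontrivial M ∧ ∀ N P : Submodule R M, IsCompl N P → N = ⊥ ∨ P = ⊥

/-- Canonical ideals of a one-dimensional Noetherian local domain, in the sense of Herzog
and Kunz: a nonzero ideal `I` with `I : (I : J) = J` for every nonzero fractional ideal `J`. -/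
def IsCanonicalIdeal {R : Type*} [CommRing R] [IsDomain R] (I : Ideal R) : Prop :=
  I ≠ ⊥ ∧ ∀ J : FractionalIdeal R⁰ (FractionRing R), J ≠ 0 →
    (I : FractionalIdeal R⁰ (FractionRing R)) / ((I : FractionalIdeal R⁰ (FractionRing R)) / J) = J

/-! ### The numerical semigroup ring `k[[t^3, t^4, t^5]]` and the module `M` -/

/-- The numerical semigroup ring `k[[S]]`: the power series in `k[[t]]` supported in `S`. -/
def numericalSemigroupRing (k : Type*) [Field k] (S : AddSubmonoid ℕ) : Subalgebra k k⟦X⟧ where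
  carrier := {f | ∀ n, n ∉ S → PowerSeries.coeff n f = 0}
  mul_mem' := by
    intro f g hf hg n hn
    rw [PowerSeries.coeff_mul]
    refine Finset.sum_eq_zero fun p hp' => ?_
    have hp : p.1 + p.2 = n := Finset.HasAntidiagonal.mem_antidiagonal.mp hp'
    by_cases h1 : p.1 ∈ S
    · by_cases h2 : p.2 ∈ S
      · exact absurd (hp ▸ S.add_mem h1 h2) hn
      · rw [hg _ h2, mul_zero]
    · rw [hf _ h1, zero_mul]
  add_mem' := by
    intro f g hf hg n hn
    rw [map_add, hf n hn, hg n hn, add_zero]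
  algebraMap_mem' := by
    intro r n hn
    have h0 : n ≠ 0 := fun h => hn (h ▸ S.zero_mem)
    rw [PowerSeries.algebraMap_apply, Algebra.algebraMap_self, RingHom.id_apply,
      PowerSeries.coeff_C, if_neg h0]

/-- The semigroup ring contains the powers `t^n` with `n ∈ S`. -/
theorem X_pow_mem_numericalSemigroupRing (k : Type*) [Field k] {S : AddSubmonoid ℕ} {n : ℕ}
    (hn : n ∈ S) : (PowerSeries.X ^ n : k⟦X⟧) ∈ numericalSemigroupRing k S := by
  intro m hm
  rw [PowerSeries.coeff_X_pow, if_neg]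
  rintro rfl
  exact hm hn

namespace Semigroup345

variable (k : Type*) [Field k]

/-- `R = k[[t^3, t^4, t^5]]`. -/
def R : Type _ := numericalSemigroupRing k (AddSubmonoid.closure {3, 4, 5})

instance : CommRing (R k) :=
  inferInstanceAs (CommRing (numericalSemigroupRing k (AddSubmonoid.closure {3, 4, 5})))

instance : IsDomain (R k) :=
  inferInstanceAs (IsDomain (numericalSemigroupRing k (AddSubmonoid.closure {3, 4, 5})))

/-- `x = t^3`. -/
def x : R k :=
  ⟨PowerSeries.X ^ 3, X_pow_mem_numericalSemigroupRing k (AddSubmonoid.subset_closure (by simp))⟩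

/-- `y = t^4`. -/
def y : R k :=
  ⟨PowerSeries.X ^ 4, X_pow_mem_numericalSemigroupRing k (AddSubmonoid.subset_closure (by simp))⟩

/-- `z = t^5`. -/
def z : R k :=
  ⟨PowerSeries.X ^ 5, X_pow_mem_numericalSemigroupRing k (AddSubmonoid.subset_closure (by simp))⟩

/-- The ideal `I = (x, y)`. -/
def I : Ideal (R k) := Ideal.span {x k, y k}

/-- The matrix whose cokernel is `M`. -/
def A : Matrix (Fin 3) (Fin 3) (R k) :=
  !![y k, z k, x k ^ 2;
     -x k, -y k, -z k;
     z k, x k ^ 2, x k * y k]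

/-- `M = R³ / im A`, where `im A` is spanned by the columns of `A`. -/
abbrev M : Type _ := (Fin 3 → R k) ⧸ LinearMap.range (A k).mulVecLin

/-- The class in `M` of the `i`-th standard basis vector of `R³`. -/
def e (i : Fin 3) : M k := Submodule.Quotient.mk (Pi.single i 1)

/-- The values `f_i(e_j)` of the three generators `f_i` of `Hom_R(M, I)`. -/
def G : Matrix (Fin 3) (Fin 3) (R k) :=
  !![-y k, 0, x k;
     0, x k ^ 2, y k;
     x k, y k, 0]

end Semigroup345

end

open Semigroup345

namespace Semigroup345

noncomputable section

variable {k : Type*} [Field k]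

/-! Everything is computed inside `k⟦X⟧`, with `t` for the variable. `R` is the set of series with
no terms in degrees 1 and 2, and `I` is `t³` times the series with no term in degree 2. Sending the
generators `e 0`, `e 1`, `e 2` to `(1, 0)`, `(t, t²)`, `(0, 1)` embeds `M` in `k⟦X⟧²`
(`pairMap_injective`); the image is cut out by three linear conditions on coefficients
(`range_pairMap`). Torsion-freeness, the extension and its non-splitting are read off from these
conditions.

Linear maps out of `M` extend `k⟦X⟧`-linearly (`linearMap_apply`), so endomorphisms are 2×2 matrices
over `k⟦X⟧`, constrained only by the image of `e 1`. The constraint makes the `e 2`-coefficient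
modulo the maximal ideal transform by a character `χ` of `End M`, where `χ f` is that coefficient of
`f (e 2)`. An idempotent with `χ = 0` vanishes, whence indecomposability.

The form `p q' + q p' - t p p'` is unimodular over `k⟦X⟧`, and `t³` times it is the duality with
values in `I`. Since `χ` is invariant under the resulting involution, the product of `e
2`-coefficients is balanced over `End M` and detects `e 2 ⊗ e 2`. An endomorphism `f` with `f (e 2)
= 0` and `f^* (e 2) = x e 2` shows that `x` kills this tensor.

That `I` is canonical is a duality argument (`mem_div_div`): a `k`-functional separating a point
from `J` is a coefficient of multiplication by a series, and this series yields an element of `I :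
J`. -/

/-! ### Coefficient descriptions of `R` and `I` inside `k⟦X⟧`. -/

theorem mem_closure_345_iff (n : ℕ) :
    n ∈ AddSubmonoid.closure ({3, 4, 5} : Set ℕ) ↔ n ≠ 1 ∧ n ≠ 2 := by
  have h3 : 3 ∈ AddSubmonoid.closure ({3, 4, 5} : Set ℕ) := AddSubmonoid.subset_closure (by simp)
  have h4 : 4 ∈ AddSubmonoid.closure ({3, 4, 5} : Set ℕ) := AddSubmonoid.subset_closure (by simp)
  have h5 : 5 ∈ AddSubmonoid.closure ({3, 4, 5} : Set ℕ) := AddSubmonoid.subset_closure (by simp)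
  constructor
  · intro h
    have : n = 0 ∨ 3 ≤ n := by
      induction h using AddSubmonoid.closure_induction with
      | mem n hn =>
        simp only [Set.mem_insert_iff, Set.mem_singleton_iff] at hn
        omega
      | zero => simp
      | add m n _ _ hm hn => omega
    omega
  · rintro ⟨h1, h2⟩
    induction n using Nat.strong_induction_on with
    | _ n ih =>
      by_cases h6 : n < 6
      · interval_cases n
        · exact zero_mem _
        · exact absurd rfl h1
        · exact absurd rfl h2
        · exact h3
        · exact h4
        · exact h5
      · have := add_mem (ih (n - 3) (by omega) (by omega) (by omega)) h3
        rwa [Nat.sub_add_cancel (by omega)] at this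

instance : Algebra (R k) k⟦X⟧ :=
  inferInstanceAs
    (Algebra (numericalSemigroupRing k (AddSubmonoid.closure ({3, 4, 5} : Set ℕ))) k⟦X⟧)

theorem algebraMap_injective : Function.Injective (algebraMap (R k) k⟦X⟧) :=
  Subtype.val_injective

instance : FaithfulSMul (R k) k⟦X⟧ :=
  (faithfulSMul_iff_algebraMap_injective _ _).2 algebraMap_injective

instance : Module.IsTorsionFree (R k) k⟦X⟧ := Module.isTorsionFree_iff_faithfulSMul.2 inferInstance

@[simp] theorem algebraMap_x : algebraMap (R k) k⟦X⟧ (x k) = PowerSeries.X ^ 3 := rfl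
@[simp] theorem algebraMap_y : algebraMap (R k) k⟦X⟧ (y k) = PowerSeries.X ^ 4 := rfl
@[simp] theorem algebraMap_z : algebraMap (R k) k⟦X⟧ (z k) = PowerSeries.X ^ 5 := rfl

@[simp] theorem coeff_one_algebraMap (r : R k) :
    PowerSeries.coeff 1 (algebraMap (R k) k⟦X⟧ r) = 0 :=
  r.2 1 (by simp [mem_closure_345_iff])

@[simp] theorem coeff_two_algebraMap (r : R k) :
    PowerSeries.coeff 2 (algebraMap (R k) k⟦X⟧ r) = 0 :=
  r.2 2 (by simp [mem_closure_345_iff])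

theorem exists_algebraMap_eq {f : k⟦X⟧} (h1 : PowerSeries.coeff 1 f = 0)
    (h2 : PowerSeries.coeff 2 f = 0) : ∃ r : R k, algebraMap (R k) k⟦X⟧ r = f := by
  refine ⟨⟨f, fun n hn => ?_⟩, rfl⟩
  rw [mem_closure_345_iff] at hn
  obtain rfl | rfl : n = 1 ∨ n = 2 := by omega
  · exact h1
  · exact h2

/-- An element of `R` given by a power series without terms in degrees `1` and `2`. -/
def ofSeries (f : k⟦X⟧) (h1 : PowerSeries.coeff 1 f = 0) (h2 : PowerSeries.coeff 2 f = 0) : R k :=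
  (exists_algebraMap_eq h1 h2).choose

@[simp] theorem algebraMap_ofSeries (f : k⟦X⟧) (h1 : PowerSeries.coeff 1 f = 0)
    (h2 : PowerSeries.coeff 2 f = 0) : algebraMap (R k) k⟦X⟧ (ofSeries f h1 h2) = f :=
  (exists_algebraMap_eq h1 h2).choose_spec

theorem exists_algebraMap_eq_X_cube_mul (f : k⟦X⟧) :
    ∃ r : R k, algebraMap (R k) k⟦X⟧ r = PowerSeries.X ^ 3 * f :=
  exists_algebraMap_eq (by simp [PowerSeries.coeff_X_pow_mul'])
    (by simp [PowerSeries.coeff_X_pow_mul'])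

theorem coeff_zero_mul' (f g : k⟦X⟧) : PowerSeries.coeff 0 (f * g) =
    PowerSeries.coeff 0 f * PowerSeries.coeff 0 g := by
  simp

theorem coeff_one_mul' (f g : k⟦X⟧) : PowerSeries.coeff 1 (f * g) =
    PowerSeries.coeff 0 f * PowerSeries.coeff 1 g +
      PowerSeries.coeff 1 f * PowerSeries.coeff 0 g := by
  rw [PowerSeries.coeff_mul]
  simp [Finset.Nat.antidiagonal_succ]

theorem coeff_two_mul' (f g : k⟦X⟧) : PowerSeries.coeff 2 (f * g) =
    PowerSeries.coeff 0 f * PowerSeries.coeff 2 g +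
      PowerSeries.coeff 1 f * PowerSeries.coeff 1 g +
      PowerSeries.coeff 2 f * PowerSeries.coeff 0 g := by
  rw [PowerSeries.coeff_mul]
  simp [Finset.Nat.antidiagonal_succ, add_assoc]

/-- The ideal `I` consists of the series `t³ h` such that `h` has no term in degree `2`. -/
theorem mem_I_iff (r : R k) : r ∈ I k ↔ ∃ h : k⟦X⟧, PowerSeries.coeff 2 h = 0 ∧
    algebraMap (R k) k⟦X⟧ r = PowerSeries.X ^ 3 * h := by
  rw [I, Ideal.mem_span_pair]
  constructor
  · rintro ⟨a, b, rfl⟩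
    refine ⟨algebraMap _ _ a + PowerSeries.X * algebraMap _ _ b, ?_, ?_⟩
    · rw [map_add, coeff_two_mul']
      simp [PowerSeries.coeff_X]
    · simp only [map_add, map_mul, algebraMap_x, algebraMap_y]
      ring
  · rintro ⟨h, h2, hr⟩
    obtain ⟨b, hb⟩ := exists_algebraMap_eq (k := k)
      (f := PowerSeries.C (PowerSeries.coeff 1 h)) (by simp) (by simp)
    obtain ⟨a, ha⟩ := exists_algebraMap_eq (k := k)
      (f := h - PowerSeries.X * PowerSeries.C (PowerSeries.coeff 1 h))
      (by rw [map_sub, coeff_one_mul']; simp)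
      (by rw [map_sub, coeff_two_mul']; simp [h2, PowerSeries.coeff_X, PowerSeries.coeff_C])
    refine ⟨a, b, algebraMap_injective ?_⟩
    rw [map_add, map_mul, map_mul, ha, hb, hr, algebraMap_x, algebraMap_y]
    ring

/-- Multiplied by `t³`, this says that `t³ k⟦X⟧` is the ideal `(x, y, z)`; it supplies the preimages
under `A` in `pairMap_injective`. -/
theorem exists_eq_add_X_mul_add_X_sq_mul (w : k⟦X⟧) : ∃ a b c : R k,
    w = algebraMap _ _ a + PowerSeries.X * algebraMap _ _ b +
      PowerSeries.X ^ 2 * algebraMap _ _ c := by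
  refine ⟨ofSeries (w - PowerSeries.X * PowerSeries.C (PowerSeries.coeff 1 w) -
      PowerSeries.X ^ 2 * PowerSeries.C (PowerSeries.coeff 2 w)) ?_ ?_,
    ofSeries (PowerSeries.C (PowerSeries.coeff 1 w)) ?_ ?_,
    ofSeries (PowerSeries.C (PowerSeries.coeff 2 w)) ?_ ?_, ?_⟩
  any_goals simp [PowerSeries.coeff_X, PowerSeries.coeff_X_pow]
  ring

theorem A_mulVec_zero (v : Fin 3 → R k) :
    (A k).mulVec v 0 = y k * v 0 + z k * v 1 + x k ^ 2 * v 2 := by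
  simp [A, Matrix.mulVec, dotProduct, Fin.sum_univ_three]

theorem A_mulVec_one (v : Fin 3 → R k) :
    (A k).mulVec v 1 = -x k * v 0 + -y k * v 1 + -z k * v 2 := by
  simp [A, Matrix.mulVec, dotProduct, Fin.sum_univ_three]

theorem A_mulVec_two (v : Fin 3 → R k) :
    (A k).mulVec v 2 = z k * v 0 + x k ^ 2 * v 1 + x k * y k * v 2 := by
  simp [A, Matrix.mulVec, dotProduct, Fin.sum_univ_three]

/-! ### The module `M` as a submodule of `k[[t]]²` -/

/-- The map `M → k[[t]]²` with `(a, b, c) ↦ (a + t b, c + t² b)`. -/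
def pairMap (k : Type*) [Field k] : M k →ₗ[R k] k⟦X⟧ × k⟦X⟧ :=
  Submodule.liftQ _
    (Fintype.linearCombination (R k)
      ![((1, 0) : k⟦X⟧ × k⟦X⟧), (PowerSeries.X, PowerSeries.X ^ 2), (0, 1)]) (by
    rintro _ ⟨v, rfl⟩
    rw [LinearMap.mem_ker, Fintype.linearCombination_apply, Fin.sum_univ_three]
    rw [Matrix.mulVecLin_apply, A_mulVec_zero, A_mulVec_one, A_mulVec_two]
    ext1 <;>
    · simp only [Prod.fst_add, Prod.snd_add, Prod.smul_fst, Prod.smul_snd, Matrix.cons_val,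
        Prod.fst_zero, Prod.snd_zero]
      simp only [Algebra.smul_def, map_add, map_mul, map_neg, map_pow, algebraMap_x, algebraMap_y,
        algebraMap_z]
      ring)

theorem pairMap_mk (v : Fin 3 → R k) : pairMap k (Submodule.Quotient.mk v) =
    (algebraMap _ _ (v 0) + PowerSeries.X * algebraMap _ _ (v 1),
      algebraMap _ _ (v 2) + PowerSeries.X ^ 2 * algebraMap _ _ (v 1)) := by
  change Fintype.linearCombination (R k) _ v = _
  rw [Fintype.linearCombination_apply, Fin.sum_univ_three]
  ext1 <;> simp [Algebra.smul_def, mul_comm, add_comm]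

@[simp] theorem pairMap_e_zero : pairMap k (e k 0) = (1, 0) := by simp [e, pairMap_mk]
@[simp] theorem pairMap_e_one : pairMap k (e k 1) = (PowerSeries.X, PowerSeries.X ^ 2) := by
  simp [e, pairMap_mk]
@[simp] theorem pairMap_e_two : pairMap k (e k 2) = (0, 1) := by simp [e, pairMap_mk]

theorem eq_sum_e (m : M k) : ∃ a b c : R k, m = a • e k 0 + b • e k 1 + c • e k 2 := by
  obtain ⟨v, rfl⟩ := Submodule.Quotient.mk_surjective _ m
  refine ⟨v 0, v 1, v 2, ?_⟩
  simp only [e, ← Submodule.Quotient.mk_smul, ← Submodule.Quotient.mk_add]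
  congr 1
  ext i
  fin_cases i <;> simp

/-- If `a + t b = 0` with `a` in `R`, then `b` has no constant term, so `b = t³ w`. Splitting `w`
over `1, t, t²` exhibits `(a, b, c)` as a combination of the columns of `A`. -/
theorem pairMap_injective : Function.Injective (pairMap k) := by
  rw [← LinearMap.ker_eq_bot, LinearMap.ker_eq_bot']
  intro m hm
  obtain ⟨v, rfl⟩ := Submodule.Quotient.mk_surjective _ m
  rw [pairMap_mk, Prod.mk_eq_zero] at hm
  obtain ⟨h0, h2⟩ := hm
  rw [Submodule.Quotient.mk_eq_zero]
  have hc : PowerSeries.coeff 0 (algebraMap (R k) k⟦X⟧ (v 1)) = 0 := by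
    have := congrArg (PowerSeries.coeff 1) h0
    rw [map_add, coeff_one_mul'] at this
    simpa using this
  obtain ⟨w, hw⟩ : PowerSeries.X ^ 3 ∣ algebraMap (R k) k⟦X⟧ (v 1) := by
    rw [PowerSeries.X_pow_dvd_iff]
    intro n hn
    interval_cases n <;> simp [hc]
  obtain ⟨a, b, c, habc⟩ := exists_eq_add_X_mul_add_X_sq_mul w
  refine ⟨![-a, -b, -c], ?_⟩
  rw [Matrix.mulVecLin_apply]
  ext i
  apply algebraMap_injective
  fin_cases i <;>
    simp only [Fin.zero_eta, Fin.mk_one, Fin.reduceFinMk, A_mulVec_zero, A_mulVec_one,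
      A_mulVec_two, Matrix.cons_val, map_add, map_mul, map_neg, map_pow, algebraMap_x,
      algebraMap_y, algebraMap_z]
  · rw [eq_neg_of_add_eq_zero_left h0, hw, habc]
    ring
  · rw [hw, habc]
    ring
  · rw [eq_neg_of_add_eq_zero_left h2, hw, habc]
    ring

instance : Module.IsTorsionFree (R k) (M k) :=
  pairMap_injective.moduleIsTorsionFree _ (map_smul _)

theorem range_pairMap (w : k⟦X⟧ × k⟦X⟧) : w ∈ LinearMap.range (pairMap k) ↔
    PowerSeries.coeff 2 w.1 = 0 ∧ PowerSeries.coeff 1 w.2 = 0 ∧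
      PowerSeries.coeff 1 w.1 = PowerSeries.coeff 2 w.2 := by
  obtain ⟨p, q⟩ := w
  constructor
  · rintro ⟨m, hm⟩
    obtain ⟨v, rfl⟩ := Submodule.Quotient.mk_surjective _ m
    rw [pairMap_mk, Prod.mk_inj] at hm
    obtain ⟨rfl, rfl⟩ := hm
    simp [coeff_one_mul', coeff_two_mul', PowerSeries.coeff_X_pow]
  · rintro ⟨h1, h2, h3⟩
    simp only at h1 h2 h3
    refine ⟨Submodule.Quotient.mk
      ![ofSeries (p - PowerSeries.X * PowerSeries.C (PowerSeries.coeff 1 p)) ?_ ?_,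
        ofSeries (PowerSeries.C (PowerSeries.coeff 1 p)) ?_ ?_,
        ofSeries (q - PowerSeries.X ^ 2 * PowerSeries.C (PowerSeries.coeff 1 p)) ?_ ?_], ?_⟩
    any_goals simp [PowerSeries.coeff_X, PowerSeries.coeff_X_pow,
      h1, h2, h3]
    rw [pairMap_mk]
    simp

theorem coeff_two_fst (m : M k) : PowerSeries.coeff 2 (pairMap k m).1 = 0 :=
  ((range_pairMap _).1 ⟨m, rfl⟩).1

theorem coeff_one_snd (m : M k) : PowerSeries.coeff 1 (pairMap k m).2 = 0 :=
  ((range_pairMap _).1 ⟨m, rfl⟩).2.1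

theorem coeff_two_snd (m : M k) :
    PowerSeries.coeff 2 (pairMap k m).2 = PowerSeries.coeff 1 (pairMap k m).1 :=
  ((range_pairMap _).1 ⟨m, rfl⟩).2.2.symm

theorem exists_pairMap_eq {p q : k⟦X⟧} (h1 : PowerSeries.coeff 2 p = 0)
    (h2 : PowerSeries.coeff 1 q = 0) (h3 : PowerSeries.coeff 1 p = PowerSeries.coeff 2 q) :
    ∃ m, pairMap k m = (p, q) :=
  (range_pairMap (p, q)).2 ⟨h1, h2, h3⟩

/-- A linear map into `k[[t]]²` with values in the image of `M` factors through `M`. -/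
theorem exists_pairMap_comp_eq {L : Type*} [AddCommGroup L] [Module (R k) L]
    (F : L →ₗ[R k] k⟦X⟧ × k⟦X⟧) (h : ∀ l, F l ∈ LinearMap.range (pairMap k)) :
    ∃ f : L →ₗ[R k] M k, ∀ l, pairMap k (f l) = F l := by
  let φ := LinearEquiv.ofInjective (pairMap k) pairMap_injective
  refine ⟨φ.symm.toLinearMap ∘ₗ F.codRestrict _ h, fun l => ?_⟩
  exact congrArg Subtype.val (φ.apply_symm_apply ⟨F l, h l⟩)

/-- A linear map `M → k[[t]]` is determined by its values on `e₀` and `e₂`, by the formula for the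
extension of scalars. -/
theorem linearMap_apply_one (g : M k →ₗ[R k] k⟦X⟧) :
    g (e k 1) = PowerSeries.X * g (e k 0) + PowerSeries.X ^ 2 * g (e k 2) := by
  -- The relation given by the first column of `A`; dividing its image by `t³` is possible in
  -- `k⟦X⟧`.
  have h : x k • e k 1 = y k • e k 0 + z k • e k 2 := by
    apply pairMap_injective
    simp only [map_add, map_smul, pairMap_e_zero, pairMap_e_one, pairMap_e_two]
    ext1 <;> simp [Algebra.smul_def] <;> ring
  have h' := congrArg g h
  simp only [map_add, map_smul, Algebra.smul_def, algebraMap_x, algebraMap_y, algebraMap_z] at h'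
  refine mul_left_cancel₀ (pow_ne_zero 3 (PowerSeries.X_ne_zero (R := k))) ?_
  rw [h']
  ring

/-- Applied to both coordinates of an endomorphism, this turns it into a 2×2 matrix over `k⟦X⟧`. -/
theorem linearMap_apply (g : M k →ₗ[R k] k⟦X⟧) (m : M k) :
    g m = (pairMap k m).1 * g (e k 0) + (pairMap k m).2 * g (e k 2) := by
  obtain ⟨a, b, c, rfl⟩ := eq_sum_e m
  simp only [map_add, map_smul, pairMap_e_zero, pairMap_e_one, pairMap_e_two, linearMap_apply_one,
    Prod.fst_add, Prod.snd_add, Prod.smul_fst, Prod.smul_snd]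
  simp only [Algebra.smul_def]
  ring

theorem end_apply_fst (f : Module.End (R k) (M k)) (m : M k) : (pairMap k (f m)).1 =
    (pairMap k m).1 * (pairMap k (f (e k 0))).1 + (pairMap k m).2 * (pairMap k (f (e k 2))).1 :=
  linearMap_apply (LinearMap.fst _ _ _ ∘ₗ pairMap k ∘ₗ f) m

theorem end_apply_snd (f : Module.End (R k) (M k)) (m : M k) : (pairMap k (f m)).2 =
    (pairMap k m).1 * (pairMap k (f (e k 0))).2 + (pairMap k m).2 * (pairMap k (f (e k 2))).2 :=
  linearMap_apply (LinearMap.snd _ _ _ ∘ₗ pairMap k ∘ₗ f) m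

/-- An endomorphism of `M` with prescribed values on `e₀` and `e₂`. -/
theorem exists_end {u v : M k}
    (h1 : PowerSeries.coeff 0 (pairMap k u).2 = 0)
    (h2 : PowerSeries.coeff 0 (pairMap k u).1 = PowerSeries.coeff 0 (pairMap k v).2)
    (h3 : PowerSeries.coeff 1 (pairMap k u).1 = -PowerSeries.coeff 0 (pairMap k v).1) :
    ∃ f : Module.End (R k) (M k), f (e k 0) = u ∧ f (e k 2) = v := by
  let F : M k →ₗ[R k] k⟦X⟧ × k⟦X⟧ :=
    (LinearMap.toSpanSingleton k⟦X⟧ _ (pairMap k u)).restrictScalars (R k) ∘ₗ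
        LinearMap.fst _ _ _ ∘ₗ pairMap k +
      (LinearMap.toSpanSingleton k⟦X⟧ _ (pairMap k v)).restrictScalars (R k) ∘ₗ
        LinearMap.snd _ _ _ ∘ₗ pairMap k
  have hF (m) : F m = (pairMap k m).1 • pairMap k u + (pairMap k m).2 • pairMap k v := rfl
  -- The three hypotheses say exactly that `t u + t² v`, the forced image of `e 1`, satisfies the
  -- conditions of `range_pairMap`.
  obtain ⟨f, hf⟩ := exists_pairMap_comp_eq F (fun m => by
    rw [range_pairMap, hF]
    simp only [Prod.fst_add, Prod.snd_add, Prod.smul_fst, Prod.smul_snd, smul_eq_mul, map_add,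
      coeff_one_mul', coeff_two_mul', coeff_two_fst, coeff_one_snd, coeff_two_snd, h1, h2, h3]
    refine ⟨?_, ?_, ?_⟩ <;> ring)
  refine ⟨f, pairMap_injective ?_, pairMap_injective ?_⟩ <;> simp [hf, hF]

/-! ### The extension `0 → R → M → I → 0` -/

theorem exists_linearMap_I {L : Type*} [AddCommGroup L] [Module (R k) L] (g : L →ₗ[R k] k⟦X⟧)
    (hg : ∀ l, PowerSeries.coeff 2 (g l) = 0) :
    ∃ t : L →ₗ[R k] I k, ∀ l, algebraMap (R k) k⟦X⟧ (t l) = PowerSeries.X ^ 3 * g l := by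
  have h (l) : ∃ i : I k, algebraMap (R k) k⟦X⟧ i = PowerSeries.X ^ 3 * g l := by
    obtain ⟨r, hr⟩ := exists_algebraMap_eq_X_cube_mul (g l)
    exact ⟨⟨r, (mem_I_iff r).2 ⟨g l, hg l, hr⟩⟩, hr⟩
  choose t ht using h
  refine ⟨{ toFun := t, map_add' := fun a b => ?_, map_smul' := fun r a => ?_ }, ht⟩
  · apply Subtype.ext
    apply algebraMap_injective
    simp [ht, mul_add]
  · apply Subtype.ext
    apply algebraMap_injective
    simp [ht, Algebra.smul_def, mul_left_comm]

theorem exists_extension : ∃ (s : R k →ₗ[R k] M k) (t : M k →ₗ[R k] I k),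
    s 1 = e k 2 ∧
    (t (e k 0) : R k) = x k ∧ (t (e k 1) : R k) = y k ∧ (t (e k 2) : R k) = 0 ∧
    Function.Injective s ∧ Function.Exact s t ∧ Function.Surjective t ∧
    ¬ ∃ u : I k →ₗ[R k] M k, t ∘ₗ u = LinearMap.id := by
  obtain ⟨t, ht⟩ := exists_linearMap_I (LinearMap.fst _ _ _ ∘ₗ pairMap k) coeff_two_fst
  simp only [LinearMap.coe_comp, Function.comp_apply, LinearMap.fst_apply] at ht
  have hs (r : R k) : pairMap k (r • e k 2) = (0, algebraMap _ _ r) := by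
    rw [map_smul, pairMap_e_two]
    ext1 <;> simp [Algebra.smul_def]
  refine ⟨LinearMap.toSpanSingleton (R k) (M k) (e k 2), t, by simp, ?_, ?_, ?_, ?_, ?_, ?_, ?_⟩
  · apply algebraMap_injective
    simp [ht]
  · apply algebraMap_injective
    simp [ht, pow_succ]
  · apply algebraMap_injective
    simp [ht]
  · intro a b hab
    have := congrArg (fun m => (pairMap k m).2) hab
    simp only [LinearMap.toSpanSingleton_apply, hs] at this
    exact algebraMap_injective this
  · intro m
    have h0 : t m = 0 ↔ (pairMap k m).1 = 0 := by
      rw [← Subtype.coe_inj, ← algebraMap_injective.eq_iff, ht]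
      simp
    rw [h0]
    constructor
    · intro h
      refine ⟨ofSeries (pairMap k m).2 (coeff_one_snd m) (by rw [coeff_two_snd, h, map_zero]),
        pairMap_injective ?_⟩
      rw [LinearMap.toSpanSingleton_apply, hs, algebraMap_ofSeries, ← h]
    · rintro ⟨r, rfl⟩
      rw [LinearMap.toSpanSingleton_apply, hs]
  · rintro ⟨i, hi⟩
    obtain ⟨h, h2, hr⟩ := (mem_I_iff i).1 hi
    obtain ⟨m, hm⟩ := exists_pairMap_eq (p := h)
      (q := PowerSeries.X ^ 2 * PowerSeries.C (PowerSeries.coeff 1 h)) h2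
      (by simp [PowerSeries.coeff_X_pow]) (by simp [PowerSeries.coeff_X_pow])
    refine ⟨m, Subtype.ext (algebraMap_injective ?_)⟩
    rw [ht, hr, hm]
  · rintro ⟨u, hu⟩
    have hu' (i : I k) : algebraMap (R k) k⟦X⟧ i = PowerSeries.X ^ 3 * (pairMap k (u i)).1 := by
      rw [← ht]
      exact congrArg (fun i : I k => algebraMap (R k) k⟦X⟧ i) (LinearMap.congr_fun hu i).symm
    have hx : x k ∈ I k := Ideal.subset_span (by simp)
    have hy : y k ∈ I k := Ideal.subset_span (by simp)
    have hxy : x k • (⟨y k, hy⟩ : I k) = y k • ⟨x k, hx⟩ := Subtype.ext (mul_comm _ _)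
    have h := congrArg (fun i => (pairMap k (u i)).2) hxy
    -- A section would send `y` to `(t, t q)`, where `q` is the second coordinate of the image of
    -- `x`. As `q` has no linear term, `t q` has no `t²` term, whereas membership in `M` requires
    -- that coefficient to be 1.
    have hX : (PowerSeries.X : k⟦X⟧) ≠ 0 := PowerSeries.X_ne_zero
    simp only [map_smul, Prod.smul_snd] at h
    simp only [Algebra.smul_def, algebraMap_x, algebraMap_y] at h
    have hp : (pairMap k (u ⟨y k, hy⟩)).1 = PowerSeries.X :=
      mul_left_cancel₀ (pow_ne_zero 3 hX) (by rw [← hu']; rfl)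
    have hq : (pairMap k (u ⟨y k, hy⟩)).2 = PowerSeries.X * (pairMap k (u ⟨x k, hx⟩)).2 :=
      mul_left_cancel₀ (pow_ne_zero 3 hX) (by rw [h]; ring)
    have h2 := coeff_two_snd (u ⟨y k, hy⟩)
    rw [hp, hq, coeff_two_mul', coeff_one_snd] at h2
    simp [PowerSeries.coeff_X] at h2

/-! ### Rank and number of generators -/

theorem finrank_fractionRing_tensor :
    Module.finrank (FractionRing (R k)) (FractionRing (R k) ⊗[R k] M k) = 2 := by
  rw [IsLocalization.finrank_eq (FractionRing (R k)) (R k)⁰ le_rfl,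
    IsLocalizedModule.finrank_eq (R k)⁰
      (TensorProduct.mk (R k) (FractionRing (R k)) (M k) 1) le_rfl]
  have hli : LinearIndependent (R k) ![e k 0, e k 2] := by
    rw [LinearIndependent.pair_iff]
    intro a b hab
    have h := congrArg (pairMap k) hab
    simpa [Prod.ext_iff, Algebra.smul_def] using h
  have hq := rank_quotient_add_rank_of_isDomain (Submodule.span (R k) (Set.range ![e k 0, e k 2]))
  have h0 : Module.rank (R k) (M k ⧸ Submodule.span (R k) (Set.range ![e k 0, e k 2])) = 0 := by
    rw [Module.rank_eq_zero_iff_isTorsion]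
    intro m
    obtain ⟨m, rfl⟩ := Submodule.Quotient.mk_surjective _ m
    have hx : x k ≠ 0 := fun h => by simpa using congrArg (algebraMap (R k) k⟦X⟧) h
    refine ⟨⟨x k, mem_nonZeroDivisors_of_ne_zero hx⟩, ?_⟩
    change x k • (Submodule.Quotient.mk m : M k ⧸ Submodule.span (R k) (Set.range _)) = _
    rw [← Submodule.Quotient.mk_smul, Submodule.Quotient.mk_eq_zero, Matrix.range_cons,
      Matrix.range_cons, Matrix.range_empty, Set.union_empty, Set.singleton_union,
      Submodule.mem_span_pair]
    obtain ⟨a, b, c, rfl⟩ := eq_sum_e m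
    -- Again `x e 1 = y e 0 + z e 2`: the quotient by the span of `e 0` and `e 2` is killed by `x`.
    refine ⟨x k * a + y k * b, x k * c + z k * b, pairMap_injective ?_⟩
    simp only [map_add, map_smul (pairMap k), pairMap_e_zero, pairMap_e_one, pairMap_e_two,
      smul_add]
    ext1 <;> simp [Algebra.smul_def] <;> ring
  rw [h0, zero_add] at hq
  rw [Module.finrank, ← hq]
  exact (finrank_span_eq_card hli).trans (Fintype.card_fin 2)

/-- The constant coefficient. -/
def residue (k : Type*) [Field k] : R k →+* k :=
  PowerSeries.constantCoeff.comp (algebraMap (R k) k⟦X⟧)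

/-- The coordinates of the reduction of `M` modulo the maximal ideal of `R`. -/
def reduction (k : Type*) [Field k] : M k →ₛₗ[residue k] Fin 3 → k where
  toFun m := ![PowerSeries.coeff 0 (pairMap k m).1, PowerSeries.coeff 1 (pairMap k m).1,
    PowerSeries.coeff 0 (pairMap k m).2]
  map_add' m n := by
    ext i
    fin_cases i <;> simp
  map_smul' r m := by
    ext i
    fin_cases i <;> simp [residue, Algebra.smul_def, coeff_one_mul']

instance : RingHomSurjective (residue k) :=
  ⟨fun c => ⟨ofSeries (PowerSeries.C c) (by simp) (by simp), by simp [residue]⟩⟩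

theorem span_e : Submodule.span (R k) {e k 0, e k 1, e k 2} = ⊤ := by
  rw [eq_top_iff]
  rintro m -
  obtain ⟨a, b, c, rfl⟩ := eq_sum_e m
  rw [Submodule.mem_span_triple]
  exact ⟨a, b, c, rfl⟩

theorem range_reduction : Submodule.map (reduction k) ⊤ = ⊤ := by
  rw [eq_top_iff]
  rintro c -
  obtain ⟨m, hm⟩ := exists_pairMap_eq
    (p := PowerSeries.C (c 0) + PowerSeries.X * PowerSeries.C (c 1))
    (q := PowerSeries.C (c 2) + PowerSeries.X ^ 2 * PowerSeries.C (c 1))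
    (by simp [PowerSeries.coeff_X]) (by simp [PowerSeries.coeff_X_pow])
    (by simp [PowerSeries.coeff_X, PowerSeries.coeff_X_pow])
  refine ⟨m, trivial, ?_⟩
  ext i
  fin_cases i <;> simp [reduction, hm]

theorem spanFinrank_top_M : (⊤ : Submodule (R k) (M k)).spanFinrank = 3 := by
  apply le_antisymm
  · rw [← span_e]
    refine (Submodule.spanFinrank_span_le_ncard_of_finite (Set.toFinite _)).trans ?_
    refine (Set.ncard_insert_le _ _).trans (Nat.succ_le_succ ?_)
    refine (Set.ncard_insert_le _ _).trans (Nat.succ_le_succ ?_)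
    rw [Set.ncard_singleton]
  · have hfg : (⊤ : Submodule (R k) (M k)).FG := by
      rw [← span_e]
      exact Submodule.fg_span (Set.toFinite _)
    have := Submodule.spanFinrank_map_le_of_fg (reduction k) hfg
    rw [range_reduction, ← Module.finrank_eq_spanFinrank_of_free] at this
    simpa using this

/-! ### Endomorphisms of `M` -/

theorem end_e_one_fst (f : Module.End (R k) (M k)) : (pairMap k (f (e k 1))).1 =
    PowerSeries.X * (pairMap k (f (e k 0))).1 + PowerSeries.X ^ 2 * (pairMap k (f (e k 2))).1 := by
  rw [end_apply_fst, pairMap_e_one]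

theorem end_e_one_snd (f : Module.End (R k) (M k)) : (pairMap k (f (e k 1))).2 =
    PowerSeries.X * (pairMap k (f (e k 0))).2 + PowerSeries.X ^ 2 * (pairMap k (f (e k 2))).2 := by
  rw [end_apply_snd, pairMap_e_one]

/-- This and the next lemma express that `f (e 1) = t f (e 0) + t² f (e 2)` must lie in `M`. -/
theorem coeff_zero_end_e_zero_snd (f : Module.End (R k) (M k)) :
    PowerSeries.coeff 0 (pairMap k (f (e k 0))).2 = 0 := by
  have h := coeff_one_snd (f (e k 1))
  rw [end_e_one_snd] at h
  simpa [coeff_one_mul', PowerSeries.coeff_X, PowerSeries.coeff_X_pow] using h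

theorem coeff_zero_end_e_zero_fst (f : Module.End (R k) (M k)) :
    PowerSeries.coeff 0 (pairMap k (f (e k 0))).1 =
      PowerSeries.coeff 0 (pairMap k (f (e k 2))).2 := by
  have h := coeff_two_snd (f (e k 1))
  rw [end_e_one_fst, end_e_one_snd] at h
  simp [coeff_one_mul', coeff_two_mul', PowerSeries.coeff_X_pow,
    coeff_one_snd] at h
  simpa using h.symm

/-- The coefficient of `e₂` modulo the maximal ideal is an eigenvector of the transpose of every
endomorphism of `M`. -/
theorem coeff_zero_end_snd (f : Module.End (R k) (M k)) (m : M k) :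
    PowerSeries.coeff 0 (pairMap k (f m)).2 =
      PowerSeries.coeff 0 (pairMap k m).2 * PowerSeries.coeff 0 (pairMap k (f (e k 2))).2 := by
  rw [end_apply_snd, map_add, coeff_zero_mul', coeff_zero_mul', coeff_zero_end_e_zero_snd]
  simp

theorem eq_zero_of_forall_X_pow_dvd {f : k⟦X⟧} (h : ∀ n, PowerSeries.X ^ n ∣ f) : f = 0 := by
  ext n
  exact PowerSeries.X_pow_dvd_iff.1 (h (n + 1)) n n.lt_succ_self

theorem X_cube_dvd_of_coeff_eq_zero {f : k⟦X⟧} (h0 : PowerSeries.coeff 0 f = 0)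
    (h1 : PowerSeries.coeff 1 f = 0) (h2 : PowerSeries.coeff 2 f = 0) : PowerSeries.X ^ 3 ∣ f := by
  rw [PowerSeries.X_pow_dvd_iff]
  intro n hn
  interval_cases n <;> assumption

/-- Once `χ f = 0`, rewriting `f` as `f ∘ f` kills the low coefficients one after another, so all
values of `f` are divisible by `t`. Then each further use of `f = f ∘ f` raises the divisibility by
one, and the values vanish. -/
theorem end_eq_zero_of_isIdempotentElem {f : Module.End (R k) (M k)} (hf : IsIdempotentElem f)
    (h : PowerSeries.coeff 0 (pairMap k (f (e k 2))).2 = 0) : f = 0 := by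
  have hff (m) : f (f m) = f m := LinearMap.congr_fun hf m
  have hq0 (m) : PowerSeries.coeff 0 (pairMap k (f m)).2 = 0 := by
    rw [coeff_zero_end_snd, h, mul_zero]
  have hp0 (m) : PowerSeries.coeff 0 (pairMap k (f m)).1 = 0 := by
    rw [← hff, end_apply_fst, map_add, coeff_zero_mul', coeff_zero_mul',
      coeff_zero_end_e_zero_fst, h, hq0, mul_zero, zero_mul, add_zero]
  have hp1 (m) : PowerSeries.coeff 1 (pairMap k (f m)).1 = 0 := by
    rw [← hff, end_apply_fst, map_add, coeff_one_mul', coeff_one_mul', hp0, hp0, hp0, hq0]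
    simp
  have h3 (m) : PowerSeries.X ^ 3 ∣ (pairMap k (f m)).1 ∧ PowerSeries.X ^ 3 ∣ (pairMap k (f m)).2 :=
    ⟨X_cube_dvd_of_coeff_eq_zero (hp0 m) (hp1 m) (coeff_two_fst _),
      X_cube_dvd_of_coeff_eq_zero (hq0 m) (coeff_one_snd _) ((coeff_two_snd _).trans (hp1 m))⟩
  have hn (n : ℕ) : ∀ m, PowerSeries.X ^ n ∣ (pairMap k (f m)).1 ∧
      PowerSeries.X ^ n ∣ (pairMap k (f m)).2 := by
    induction n with
    | zero => simp
    | succ n ih =>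
      intro m
      have hX : (PowerSeries.X : k⟦X⟧) ∣ PowerSeries.X ^ 3 := dvd_pow_self _ three_ne_zero
      rw [← hff, end_apply_fst f (f m), end_apply_snd f (f m), pow_succ]
      exact ⟨dvd_add (mul_dvd_mul (ih _).1 (hX.trans (h3 _).1))
        (mul_dvd_mul (ih _).2 (hX.trans (h3 _).1)), dvd_add (mul_dvd_mul (ih _).1
        (hX.trans (h3 _).2)) (mul_dvd_mul (ih _).2 (hX.trans (h3 _).2))⟩
  refine LinearMap.ext fun m => pairMap_injective ?_
  rw [LinearMap.zero_apply, map_zero]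
  exact Prod.ext (eq_zero_of_forall_X_pow_dvd fun n => (hn n m).1)
    (eq_zero_of_forall_X_pow_dvd fun n => (hn n m).2)

theorem isIndecomposableModule_M : IsIndecomposableModule (R k) (M k) := by
  refine ⟨⟨e k 2, 0, fun h => ?_⟩, fun N P h => ?_⟩
  · simpa using congrArg (pairMap k) h
  · let f : Module.End (R k) (M k) := N.projection P h
    have hf : IsIdempotentElem f := LinearMap.ext fun m =>
      Submodule.projection_apply_of_mem_left h (Submodule.projection_apply_mem h m)
    have hχ : PowerSeries.coeff 0 (pairMap k (f (e k 2))).2 = 0 ∨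
        PowerSeries.coeff 0 (pairMap k (f (e k 2))).2 = 1 := by
      -- Multiplicativity of `χ` gives `χ f = (χ f)²` in the field `k`.
      have := coeff_zero_end_snd f (f (e k 2))
      rw [show f (f (e k 2)) = f (e k 2) from LinearMap.congr_fun hf _] at this
      rwa [← IsIdempotentElem.iff_eq_zero_or_one, IsIdempotentElem, eq_comm]
    rcases hχ with h0 | h1
    · left
      rw [← Submodule.range_projection h]
      exact LinearMap.range_eq_bot.2 (end_eq_zero_of_isIdempotentElem hf h0)
    · right
      have h1' : PowerSeries.coeff 0 (pairMap k ((1 - f) (e k 2))).2 = 0 := by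
        rw [LinearMap.sub_apply, map_sub, Prod.snd_sub, map_sub, h1]
        simp
      have hf1 := end_eq_zero_of_isIdempotentElem hf.one_sub h1'
      rw [eq_bot_iff]
      intro m hm
      have hm1 := LinearMap.congr_fun hf1 m
      rwa [LinearMap.sub_apply, Submodule.projection_apply_of_mem_right h hm, sub_zero] at hm1

/-! ### The tensor square of `M` -/

instance : Algebra k (R k) :=
  inferInstanceAs
    (Algebra k (numericalSemigroupRing k (AddSubmonoid.closure ({3, 4, 5} : Set ℕ))))

@[simp] theorem algebraMap_algebraMap (c : k) :
    algebraMap (R k) k⟦X⟧ (algebraMap k (R k) c) = PowerSeries.C c := rfl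

/-- For `r` in the maximal ideal, `t r` and `t² r` lie in `R`, so `r e 1` is absorbed by `e 0` and
`e 2`; only a constant multiple of `e 1` remains. -/
theorem eq_sum_e' (m : M k) : ∃ (a c : R k) (b : k),
    m = a • e k 0 + algebraMap k (R k) b • e k 1 + c • e k 2 := by
  obtain ⟨a, ha⟩ := exists_algebraMap_eq (k := k)
    (f := (pairMap k m).1 - PowerSeries.X * PowerSeries.C (PowerSeries.coeff 1 (pairMap k m).1))
    (by simp) (by simp [PowerSeries.coeff_X, coeff_two_fst])
  obtain ⟨c, hc⟩ := exists_algebraMap_eq (k := k)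
    (f := (pairMap k m).2 - PowerSeries.X ^ 2 * PowerSeries.C (PowerSeries.coeff 1 (pairMap k m).1))
    (by simp [PowerSeries.coeff_X_pow, coeff_one_snd])
    (by simp [PowerSeries.coeff_X_pow, coeff_two_snd])
  refine ⟨a, c, PowerSeries.coeff 1 (pairMap k m).1, pairMap_injective ?_⟩
  simp only [map_add, map_smul, pairMap_e_zero, pairMap_e_one, pairMap_e_two]
  ext1 <;> simp only [Prod.fst_add, Prod.snd_add, Prod.smul_fst, Prod.smul_snd]
  · simp only [Algebra.smul_def, ha, hc, algebraMap_algebraMap]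
    ring
  · simp only [Algebra.smul_def, ha, hc, algebraMap_algebraMap]
    ring

/-- An element of `M ⊗ M` is a combination of the `eᵢ ⊗ eⱼ` in which the coefficients of the
tensors involving `e₁` are constants. -/
theorem eq_sum_tmul (w : M k ⊗[R k] M k) : ∃ (c₀₀ c₀₂ c₂₀ c₂₂ : R k) (b₀₁ b₁₀ b₁₂ b₂₁ b₁₁ : k),
    w = c₀₀ • e k 0 ⊗ₜ e k 0 + c₀₂ • e k 0 ⊗ₜ e k 2 + c₂₀ • e k 2 ⊗ₜ e k 0 +
      c₂₂ • e k 2 ⊗ₜ e k 2 + algebraMap k (R k) b₀₁ • e k 0 ⊗ₜ e k 1 +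
      algebraMap k (R k) b₁₀ • e k 1 ⊗ₜ e k 0 + algebraMap k (R k) b₁₂ • e k 1 ⊗ₜ e k 2 +
      algebraMap k (R k) b₂₁ • e k 2 ⊗ₜ e k 1 + algebraMap k (R k) b₁₁ • e k 1 ⊗ₜ e k 1 := by
  let P (w : M k ⊗[R k] M k) : Prop := ∃ (c₀₀ c₀₂ c₂₀ c₂₂ : R k) (b₀₁ b₁₀ b₁₂ b₂₁ b₁₁ : k),
    w = c₀₀ • e k 0 ⊗ₜ e k 0 + c₀₂ • e k 0 ⊗ₜ e k 2 + c₂₀ • e k 2 ⊗ₜ e k 0 +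
      c₂₂ • e k 2 ⊗ₜ e k 2 + algebraMap k (R k) b₀₁ • e k 0 ⊗ₜ e k 1 +
      algebraMap k (R k) b₁₀ • e k 1 ⊗ₜ e k 0 + algebraMap k (R k) b₁₂ • e k 1 ⊗ₜ e k 2 +
      algebraMap k (R k) b₂₁ • e k 2 ⊗ₜ e k 1 + algebraMap k (R k) b₁₁ • e k 1 ⊗ₜ e k 1
  have hadd {v w} (hv : P v) (hw : P w) : P (v + w) := by
    obtain ⟨c₀₀, c₀₂, c₂₀, c₂₂, b₀₁, b₁₀, b₁₂, b₂₁, b₁₁, rfl⟩ := hv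
    obtain ⟨d₀₀, d₀₂, d₂₀, d₂₂, a₀₁, a₁₀, a₁₂, a₂₁, a₁₁, rfl⟩ := hw
    refine ⟨c₀₀ + d₀₀, c₀₂ + d₀₂, c₂₀ + d₂₀, c₂₂ + d₂₂, b₀₁ + a₀₁, b₁₀ + a₁₀, b₁₂ + a₁₂,
      b₂₁ + a₂₁, b₁₁ + a₁₁, ?_⟩
    simp only [map_add, add_smul]
    abel
  have h0l (m : M k) : P (e k 0 ⊗ₜ m) := by
    obtain ⟨a, c, b, rfl⟩ := eq_sum_e' m
    exact ⟨a, c, 0, 0, b, 0, 0, 0, 0, by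
      simp only [TensorProduct.tmul_add, TensorProduct.tmul_smul, map_zero, zero_smul]; abel⟩
  have h2l (m : M k) : P (e k 2 ⊗ₜ m) := by
    obtain ⟨a, c, b, rfl⟩ := eq_sum_e' m
    exact ⟨0, 0, a, c, 0, 0, 0, b, 0, by
      simp only [TensorProduct.tmul_add, TensorProduct.tmul_smul, map_zero, zero_smul]; abel⟩
  have h0r (m : M k) : P (m ⊗ₜ e k 0) := by
    obtain ⟨a, c, b, rfl⟩ := eq_sum_e' m
    exact ⟨a, 0, c, 0, 0, b, 0, 0, 0, by
      simp only [TensorProduct.add_tmul, TensorProduct.smul_tmul', map_zero, zero_smul]; abel⟩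
  have h2r (m : M k) : P (m ⊗ₜ e k 2) := by
    obtain ⟨a, c, b, rfl⟩ := eq_sum_e' m
    exact ⟨0, a, 0, c, 0, 0, b, 0, 0, by
      simp only [TensorProduct.add_tmul, TensorProduct.smul_tmul', map_zero, zero_smul]; abel⟩
  have h11 (b : k) : P (algebraMap k (R k) b • e k 1 ⊗ₜ e k 1) :=
    ⟨0, 0, 0, 0, 0, 0, 0, 0, b, by simp only [map_zero, zero_smul]; abel⟩
  change P w
  induction w with
  | zero => exact ⟨0, 0, 0, 0, 0, 0, 0, 0, 0, by simp⟩
  | add v w hv hw => exact hadd hv hw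
  | tmul m n =>
    obtain ⟨a, c, b, rfl⟩ := eq_sum_e' m
    -- The scalar `b` is moved to the right factor before expanding it, so that only `e 1 ⊗ e 1`
    -- with a constant coefficient escapes the four cases above.
    obtain ⟨a', c', b', hn⟩ := eq_sum_e' (algebraMap k (R k) b • n)
    have : (a • e k 0 + algebraMap k (R k) b • e k 1 + c • e k 2) ⊗ₜ[R k] n =
        e k 0 ⊗ₜ (a • n) + (a' • e k 1) ⊗ₜ e k 0 + algebraMap k (R k) b' • e k 1 ⊗ₜ e k 1 +
          (c' • e k 1) ⊗ₜ e k 2 + e k 2 ⊗ₜ (c • n) := by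
      rw [TensorProduct.add_tmul, TensorProduct.add_tmul, TensorProduct.smul_tmul,
        TensorProduct.smul_tmul, TensorProduct.smul_tmul, hn]
      simp only [TensorProduct.tmul_add, TensorProduct.tmul_smul, TensorProduct.smul_tmul']
      abel
    rw [this]
    exact hadd (hadd (hadd (hadd (h0l _) (h0r _)) (h11 _)) (h2r _)) (h2l _)

/-- The map `M ⊗ M → k[[t]]⁴` induced by `M → k[[t]]²`. -/
def tensorMap (k : Type*) [Field k] :
    M k ⊗[R k] M k →ₗ[R k] (k⟦X⟧ × k⟦X⟧) × (k⟦X⟧ × k⟦X⟧) :=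
  let μ (g h : M k →ₗ[R k] k⟦X⟧) : M k ⊗[R k] M k →ₗ[R k] k⟦X⟧ :=
    TensorProduct.lift ((LinearMap.mul (R k) k⟦X⟧).compl₁₂ g h)
  let p := LinearMap.fst _ _ _ ∘ₗ pairMap k
  let q := LinearMap.snd _ _ _ ∘ₗ pairMap k
  ((μ p p).prod (μ p q)).prod ((μ q p).prod (μ q q))

theorem tensorMap_tmul (m n : M k) : tensorMap k (m ⊗ₜ n) =
    (((pairMap k m).1 * (pairMap k n).1, (pairMap k m).1 * (pairMap k n).2),
      ((pairMap k m).2 * (pairMap k n).1, (pairMap k m).2 * (pairMap k n).2)) := rfl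

/-- In the normal form of `eq_sum_tmul` the coefficients from `R` contribute nothing in degrees 1
and 2, so these degrees force the five constants to vanish. What remains is the `R`-independence of
the four tensors in `e 0` and `e 2`. -/
theorem tensorMap_injective : Function.Injective (tensorMap k) := by
  rw [← LinearMap.ker_eq_bot, LinearMap.ker_eq_bot']
  intro w hw
  obtain ⟨c₀₀, c₀₂, c₂₀, c₂₂, b₀₁, b₁₀, b₁₂, b₂₁, b₁₁, rfl⟩ := eq_sum_tmul w
  simp only [map_add, map_smul, tensorMap_tmul, pairMap_e_zero, pairMap_e_one, pairMap_e_two,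
    Prod.ext_iff, Prod.fst_add, Prod.snd_add, Prod.smul_fst, Prod.smul_snd, Prod.fst_zero,
    Prod.snd_zero] at hw
  simp only [Algebra.smul_def, algebraMap_algebraMap, mul_zero, mul_one, zero_mul, one_mul,
    add_zero, zero_add] at hw
  obtain ⟨⟨hpp, hpq⟩, hqp, hqq⟩ := hw
  have hpp1 := congrArg (PowerSeries.coeff 1) hpp
  have hpp2 := congrArg (PowerSeries.coeff 2) hpp
  have hpq1 := congrArg (PowerSeries.coeff 1) hpq
  have hpq2 := congrArg (PowerSeries.coeff 2) hpq
  have hqp1 := congrArg (PowerSeries.coeff 1) hqp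
  simp [PowerSeries.coeff_X, PowerSeries.coeff_X_pow]
    at hpp1 hpp2 hpq1 hpq2 hqp1
  subst hpp2 hpq1 hpq2 hqp1
  simp only [zero_add] at hpp1
  subst hpp1
  simp only [map_zero, zero_mul, add_zero] at hpp hpq hqp hqq
  rw [map_eq_zero_iff _ algebraMap_injective] at hpp hpq hqp hqq
  simp [hpp, hpq, hqp, hqq]

instance : Module.IsTorsionFree (R k) (M k ⊗[R k] M k) :=
  tensorMap_injective.moduleIsTorsionFree _ (map_smul _)

/-! ### The strong self duality -/

/-- The symmetric bilinear form `((p, q), (p', q')) ↦ p q' + q p' - t p p'` on `M`. -/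
def form (k : Type*) [Field k] : M k →ₗ[R k] M k →ₗ[R k] k⟦X⟧ :=
  let μ := LinearMap.mul (R k) k⟦X⟧
  let p := LinearMap.fst _ _ _ ∘ₗ pairMap k
  let q := LinearMap.snd _ _ _ ∘ₗ pairMap k
  μ.compl₁₂ p q + μ.compl₁₂ q p - μ.compl₁₂ (μ PowerSeries.X ∘ₗ p) p

theorem form_apply (u v : M k) : form k u v = (pairMap k u).1 * (pairMap k v).2 +
    (pairMap k u).2 * (pairMap k v).1 - PowerSeries.X * (pairMap k u).1 * (pairMap k v).1 := rfl

theorem form_comm (u v : M k) : form k u v = form k v u := by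
  rw [form_apply, form_apply]
  ring

/-- The degree 2 part of `p q' + q p'` is `p₀ p'₁ + p₁ p'₀` by the conditions on `M`, and the term
`- t p p'` cancels it. -/
theorem coeff_two_form (u v : M k) : PowerSeries.coeff 2 (form k u v) = 0 := by
  rw [form_apply]
  simp [coeff_two_mul', coeff_two_fst, coeff_one_snd,
    coeff_two_snd]

theorem exists_duality : ∃ α : StrongSelfDuality (R k) (M k) (I k),
    ∀ u v, algebraMap (R k) k⟦X⟧ (α.toEquiv u v) = PowerSeries.X ^ 3 * form k u v := by
  choose β hβ using fun u => exists_linearMap_I (form k u) (coeff_two_form u)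
  let α : M k →ₗ[R k] M k →ₗ[R k] I k :=
    { toFun := β
      map_add' := fun u v => by
        refine LinearMap.ext fun w => Subtype.ext (algebraMap_injective ?_)
        simp [hβ, mul_add]
      map_smul' := fun r u => by
        refine LinearMap.ext fun w => Subtype.ext (algebraMap_injective ?_)
        simp [hβ, Algebra.smul_def, mul_left_comm] }
  have hα (u v) : algebraMap (R k) k⟦X⟧ (α u v) = PowerSeries.X ^ 3 * form k u v := hβ u v
  have hX : (PowerSeries.X : k⟦X⟧) ^ 3 ≠ 0 := pow_ne_zero 3 PowerSeries.X_ne_zero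
  have hinj : Function.Injective α := by
    rw [← LinearMap.ker_eq_bot, LinearMap.ker_eq_bot']
    intro u hu
    have h (v) : form k u v = 0 := by
      have := hα u v
      rw [hu] at this
      exact (mul_eq_zero.1 (this.symm.trans (map_zero _))).resolve_left hX
    have h2 : (pairMap k u).1 = 0 := by simpa [form_apply] using h (e k 2)
    have h0 : (pairMap k u).2 = 0 := by simpa [form_apply, h2] using h (e k 0)
    exact pairMap_injective (by rw [map_zero]; exact Prod.ext h2 h0)
  have hsurj : Function.Surjective α := by
    intro φ
    have hφ (i) : ∃ h : k⟦X⟧, PowerSeries.coeff 2 h = 0 ∧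
        algebraMap (R k) k⟦X⟧ (φ (e k i)) = PowerSeries.X ^ 3 * h := (mem_I_iff _).1 (φ (e k i)).2
    obtain ⟨a, ha2, ha⟩ := hφ 0
    obtain ⟨b, hb2, hb⟩ := hφ 1
    obtain ⟨c, hc2, hc⟩ := hφ 2
    let g : M k →ₗ[R k] k⟦X⟧ := Algebra.linearMap (R k) k⟦X⟧ ∘ₗ (I k).subtype ∘ₗ φ
    have hg (v) : g v = algebraMap (R k) k⟦X⟧ (φ v) := rfl
    have hb' : b = PowerSeries.X * a + PowerSeries.X ^ 2 * c := by
      have := linearMap_apply_one g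
      rw [hg, hg, hg, ha, hb, hc] at this
      exact mul_left_cancel₀ hX (by rw [this]; ring)
    have hac : PowerSeries.coeff 1 a + PowerSeries.coeff 0 c = 0 := by
      rw [hb', map_add, coeff_two_mul', coeff_two_mul'] at hb2
      simpa [PowerSeries.coeff_X, PowerSeries.coeff_X_pow] using hb2
    -- Solves `form u (e 2) = p = c` and `form u (e 0) = q - t p = a`; the condition from `φ (e 1)`
    -- is what puts `u` in `M`.
    obtain ⟨u, hu⟩ := exists_pairMap_eq (p := c) (q := a + PowerSeries.X * c) hc2
      (by rw [← hac]; simp)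
      (by simp [ha2])
    refine ⟨u, LinearMap.ext fun v => Subtype.ext (algebraMap_injective ?_)⟩
    rw [hα, ← hg, linearMap_apply g, hg, hg, ha, hc, form_apply, hu]
    ring
  refine ⟨⟨LinearEquiv.ofBijective α ⟨hinj, hsurj⟩, fun u v => ?_⟩, hα⟩
  apply Subtype.ext
  apply algebraMap_injective
  change algebraMap (R k) k⟦X⟧ (α u v) = algebraMap (R k) k⟦X⟧ (α v u)
  rw [hα, hα, form_comm]

/-! ### The involution on `End M`, cyclicity, and the torsion element. -/

theorem _root_.StrongSelfDuality.toEquiv_star_apply {R M N : Type*} [CommRing R] [AddCommGroup M]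
    [Module R M] [AddCommGroup N] [Module R N] (α : StrongSelfDuality R M N) (f : Module.End R M)
    (u v : M) : α.toEquiv (α.rStarAlgebra.star f u) v = α.toEquiv u (f v) := by
  simp [StrongSelfDuality.rStarAlgebra]

theorem exists_end_apply_e_two (m : M k) : ∃ f : Module.End (R k) (M k), f (e k 2) = m := by
  -- `u` is the image chosen for `e 0`: the hypotheses of `exists_end` dictate the low coefficients
  -- of its first coordinate, and membership in `M` then dictates the `t²` term of the second.
  obtain ⟨u, hu⟩ := exists_pairMap_eq (k := k)
    (p := PowerSeries.C (PowerSeries.coeff 0 (pairMap k m).2) -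
      PowerSeries.X * PowerSeries.C (PowerSeries.coeff 0 (pairMap k m).1))
    (q := -(PowerSeries.X ^ 2 * PowerSeries.C (PowerSeries.coeff 0 (pairMap k m).1)))
    (by simp [PowerSeries.coeff_X]) (by simp [PowerSeries.coeff_X_pow])
    (by simp [PowerSeries.coeff_X, PowerSeries.coeff_X_pow])
  obtain ⟨f, -, hf⟩ := exists_end (u := u) (v := m) (by simp [hu]) (by simp [hu]) (by simp [hu])
  exact ⟨f, hf⟩

theorem form_star_apply (α : StrongSelfDuality (R k) (M k) (I k))
    (hα : ∀ u v, algebraMap (R k) k⟦X⟧ (α.toEquiv u v) = PowerSeries.X ^ 3 * form k u v)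
    (f : Module.End (R k) (M k)) (u v : M k) :
    form k (α.rStarAlgebra.star f u) v = form k u (f v) := by
  have hX : (PowerSeries.X : k⟦X⟧) ^ 3 ≠ 0 := pow_ne_zero 3 PowerSeries.X_ne_zero
  refine mul_left_cancel₀ hX ?_
  rw [← hα, ← hα, α.toEquiv_star_apply]

theorem star_apply_e_two_fst (α : StrongSelfDuality (R k) (M k) (I k))
    (hα : ∀ u v, algebraMap (R k) k⟦X⟧ (α.toEquiv u v) = PowerSeries.X ^ 3 * form k u v)
    (f : Module.End (R k) (M k)) :
    (pairMap k (α.rStarAlgebra.star f (e k 2))).1 = (pairMap k (f (e k 2))).1 := by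
  simpa [form_apply] using form_star_apply α hα f (e k 2) (e k 2)

theorem star_apply_e_two_snd (α : StrongSelfDuality (R k) (M k) (I k))
    (hα : ∀ u v, algebraMap (R k) k⟦X⟧ (α.toEquiv u v) = PowerSeries.X ^ 3 * form k u v)
    (f : Module.End (R k) (M k)) :
    (pairMap k (α.rStarAlgebra.star f (e k 2))).2 =
      (pairMap k (f (e k 0))).1 + PowerSeries.X * (pairMap k (f (e k 2))).1 := by
  have h := form_star_apply α hα f (e k 2) (e k 0)
  simp only [form_apply, pairMap_e_zero, pairMap_e_two, star_apply_e_two_fst α hα] at h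
  rw [mul_zero, mul_one, mul_one, zero_mul, one_mul, mul_zero, zero_mul, zero_add, zero_add,
    sub_zero] at h
  rw [← h]
  ring

/-- Invariance `χ (f^*) = χ f`: the two diagonal entries of the matrix of `f` agree modulo `t`, and
the involution exchanges them modulo `t`. -/
theorem coeff_zero_star_snd (α : StrongSelfDuality (R k) (M k) (I k))
    (hα : ∀ u v, algebraMap (R k) k⟦X⟧ (α.toEquiv u v) = PowerSeries.X ^ 3 * form k u v)
    (f : Module.End (R k) (M k)) (u : M k) :
    PowerSeries.coeff 0 (pairMap k (α.rStarAlgebra.star f u)).2 =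
      PowerSeries.coeff 0 (pairMap k u).2 * PowerSeries.coeff 0 (pairMap k (f (e k 2))).2 := by
  rw [coeff_zero_end_snd, star_apply_e_two_snd α hα, map_add, coeff_zero_mul',
    PowerSeries.coeff_zero_X, zero_mul, add_zero, coeff_zero_end_e_zero_fst]


theorem x_ne_zero : x k ≠ 0 := fun h => by simpa using congrArg (algebraMap (R k) k⟦X⟧) h

theorem exists_star_apply_e_two_eq_smul (α : StrongSelfDuality (R k) (M k) (I k))
    (hα : ∀ u v, algebraMap (R k) k⟦X⟧ (α.toEquiv u v) = PowerSeries.X ^ 3 * form k u v) :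
    ∃ f : Module.End (R k) (M k), f (e k 2) = 0 ∧
      α.rStarAlgebra.star f (e k 2) = x k • e k 2 := by
  have he : pairMap k (x k • e k 0) = (PowerSeries.X ^ 3, 0) := by
    rw [map_smul, pairMap_e_zero]
    ext1 <;> simp [Algebra.smul_def]
  -- The matrix `diag(t³, 0)`; its adjoint for the form sends `e 2` to `(0, t³)`.
  obtain ⟨f, hf0, hf2⟩ := exists_end (u := x k • e k 0) (v := 0) (by simp [he]) (by simp [he])
    (by simp [he, PowerSeries.coeff_X_pow])
  refine ⟨f, hf2, pairMap_injective ?_⟩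
  rw [map_smul, pairMap_e_two]
  ext1
  · simp [star_apply_e_two_fst α hα, hf2]
  · simp [star_apply_e_two_snd α hα, hf0, hf2, he, Algebra.smul_def]

/-- `k` as an `R`-module through the constant coefficient. -/
abbrev residueModule (k : Type*) [Field k] : Module (R k) k := Module.compHom k (residue k)

attribute [local instance] residueModule

theorem smul_eq_residue_mul (r : R k) (c : k) : r • c = residue k r * c := rfl

/-- The coefficient of `e₂` modulo the maximal ideal. -/
def lastCoeff (k : Type*) [Field k] : M k →ₗ[R k] k where
  toFun m := PowerSeries.coeff 0 (pairMap k m).2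
  map_add' := by simp
  map_smul' r m := by simp [smul_eq_residue_mul, residue, Algebra.smul_def]

theorem lastCoeff_apply (m : M k) : lastCoeff k m = PowerSeries.coeff 0 (pairMap k m).2 := rfl

/-- The product of the coefficients of `e₂` modulo the maximal ideal. -/
def lastCoeffMul (k : Type*) [Field k] : M k →ₗ[R k] M k →ₗ[R k] k :=
  LinearMap.mk₂ (R k) (fun m n => lastCoeff k m * lastCoeff k n)
    (by simp [add_mul]) (by simp [smul_eq_residue_mul, mul_assoc]) (by simp [mul_add])
    (by simp [smul_eq_residue_mul, mul_left_comm])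

theorem _root_.TensorOver.tmul_ne_zero {R E N M P : Type*} [CommRing R] [Ring E] [Algebra R E]
    [AddCommGroup N] [Module R N] [Module Eᵐᵒᵖ N] [AddCommGroup M] [Module R M] [Module E M]
    [AddCommGroup P] [Module R P] (φ : N ⊗[R] M →ₗ[R] P)
    (hφ : ∀ (f : E) (n : N) (m : M), φ ((MulOpposite.op f • n) ⊗ₜ m) = φ (n ⊗ₜ (f • m)))
    {n : N} {m : M} (h : φ (n ⊗ₜ m) ≠ 0) : TensorOver.tmul R E n m ≠ 0 := by
  intro h0
  have hmem := (Submodule.Quotient.mk_eq_zero _).1 h0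
  refine h (LinearMap.mem_ker.1 (Submodule.span_le.2 ?_ hmem))
  rintro _ ⟨f, n, m, rfl⟩
  exact (map_sub _ _ _).trans (sub_eq_zero.2 (hφ f n m))

theorem tmul_e_two_ne_zero (α : StrongSelfDuality (R k) (M k) (I k))
    (hα : ∀ u v, algebraMap (R k) k⟦X⟧ (α.toEquiv u v) = PowerSeries.X ^ 3 * form k u v) :
    TensorOver.tmul (R k) (Module.End (R k) (M k)) (α.rStarAlgebra.toRight (M k) (e k 2)) (e k 2)
      ≠ 0 := by
  let φ : α.rStarAlgebra.RightModule (M k) ⊗[R k] M k →ₗ[R k] k :=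
    TensorProduct.lift (lastCoeffMul k ∘ₗ (α.rStarAlgebra.toRight (M k)).symm.toLinearMap)
  have hφ (m n : M k) : φ (α.rStarAlgebra.toRight (M k) m ⊗ₜ n) = lastCoeff k m * lastCoeff k n :=
    rfl
  refine TensorOver.tmul_ne_zero φ (fun f n m => ?_) ?_
  · obtain ⟨n, rfl⟩ := (α.rStarAlgebra.toRight (M k)).surjective n
    change φ (α.rStarAlgebra.toRight (M k) (α.rStarAlgebra.star f n) ⊗ₜ m) =
      φ (α.rStarAlgebra.toRight (M k) n ⊗ₜ f m)
    rw [hφ, hφ]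
    simp only [lastCoeff_apply]
    rw [coeff_zero_star_snd α hα f n, coeff_zero_end_snd f m]
    ring
  · rw [hφ, lastCoeff_apply]
    simp

theorem x_smul_tmul_e_two (α : StrongSelfDuality (R k) (M k) (I k))
    (hα : ∀ u v, algebraMap (R k) k⟦X⟧ (α.toEquiv u v) = PowerSeries.X ^ 3 * form k u v) :
    x k • TensorOver.tmul (R k) (Module.End (R k) (M k))
      (α.rStarAlgebra.toRight (M k) (e k 2)) (e k 2) = 0 := by
  obtain ⟨f, hf, hf'⟩ := exists_star_apply_e_two_eq_smul α hα
  rw [TensorOver.tmul, ← Submodule.Quotient.mk_smul, Submodule.Quotient.mk_eq_zero]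
  apply Submodule.subset_span
  refine ⟨f, α.rStarAlgebra.toRight (M k) (e k 2), e k 2, ?_⟩
  change _ = α.rStarAlgebra.toRight (M k) (α.rStarAlgebra.star f (e k 2)) ⊗ₜ[R k] e k 2 -
    α.rStarAlgebra.toRight (M k) (e k 2) ⊗ₜ[R k] f (e k 2)
  rw [hf, hf', map_smul, TensorProduct.tmul_zero, sub_zero, TensorProduct.smul_tmul']

/-! ### The ideal `I` is canonical -/

/-- A linear functional on `k[[t]]` that vanishes on multiples of `t ^ N` reads off a coefficient
of the product with a fixed series. -/
theorem exists_coeff_mul_eq (φ : k⟦X⟧ →ₗ[k] k) (N : ℕ)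
    (hφ : ∀ f, φ (PowerSeries.X ^ N * f) = 0) :
    ∃ H : k⟦X⟧, ∀ f, PowerSeries.coeff N (H * f) = φ f := by
  refine ⟨∑ i ∈ Finset.range N, φ (PowerSeries.X ^ i) • PowerSeries.X ^ (N - i), fun f => ?_⟩
  obtain ⟨g, hg⟩ : PowerSeries.X ^ N ∣
      f - ∑ i ∈ Finset.range N, PowerSeries.coeff i f • PowerSeries.X ^ i := by
    rw [PowerSeries.X_pow_dvd_iff]
    intro m hm
    simp [PowerSeries.coeff_X_pow, hm]
  rw [sub_eq_iff_eq_add] at hg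
  have h1 : φ f = ∑ i ∈ Finset.range N, PowerSeries.coeff i f * φ (PowerSeries.X ^ i) := by
    conv_lhs => rw [hg]
    simp [hφ]
  rw [h1, Finset.sum_mul, map_sum]
  refine Finset.sum_congr rfl fun i hi => ?_
  have hi' := Finset.mem_range.1 hi
  rw [smul_mul_assoc, PowerSeries.coeff_smul, PowerSeries.coeff_X_pow_mul', if_pos (by omega),
    Nat.sub_sub_self hi'.le, smul_eq_mul, mul_comm]

/-- If `q ∉ J`, scale by `a` into `R` and take a functional `φ` that vanishes on `a J` but not on `a
q`. Writing `φ` as the coefficient of degree `n + 2` of `H · _`, the element `a t^(3-n) H`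
multiplies `J` into `I`, hence also `q`, which forces `φ (a q) = 0`. -/
theorem mem_div_div {J : FractionalIdeal (R k)⁰ (FractionRing (R k))} (hJ : J ≠ 0)
    (hIJ : (I k : FractionalIdeal (R k)⁰ (FractionRing (R k))) / J ≠ 0) {q : FractionRing (R k)}
    (hq : q ∈ (I k : FractionalIdeal (R k)⁰ (FractionRing (R k))) / (I k / J)) : q ∈ J := by
  let ι := algebraMap (R k) (FractionRing (R k))
  have hι : Function.Injective ι := IsFractionRing.injective _ _
  by_contra hqJ
  obtain ⟨a, ha, haJ, g, hg⟩ : ∃ a : R k, a ≠ 0 ∧ (∀ j ∈ J, ∃ r, ι r = ι a * j) ∧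
      ∃ g, ι g = ι a * q := by
    obtain ⟨b, hb, hbJ⟩ := J.isFractional
    obtain ⟨c, r, hr⟩ := IsLocalization.exists_integer_multiple (R k)⁰ q
    refine ⟨b * c, mul_ne_zero (nonZeroDivisors.ne_zero hb) (nonZeroDivisors.ne_zero c.2),
      fun j hj => ?_, b * r, ?_⟩
    · obtain ⟨s, hs⟩ := hbJ j hj
      refine ⟨c * s, ?_⟩
      rw [map_mul, hs, map_mul, Algebra.smul_def]
      ring
    · rw [map_mul, hr, map_mul, Algebra.smul_def]
      ring
  have hιa : ι a ≠ 0 := (map_ne_zero_iff ι hι).2 ha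
  have hJsmul (r : R k) {j} (hj : j ∈ J) : ι r * j ∈ J := by
    rw [← Algebra.smul_def]
    exact Submodule.smul_mem (J : Submodule (R k) (FractionRing (R k))) r hj
  let J' : Submodule k k⟦X⟧ :=
    { carrier := {v | ∃ r : R k, algebraMap (R k) k⟦X⟧ r = v ∧ ∃ j ∈ J, ι r = ι a * j}
      zero_mem' := ⟨0, map_zero _, 0, zero_mem (J : Submodule (R k) (FractionRing (R k))), by simp⟩
      add_mem' := by
        rintro _ _ ⟨r, rfl, j, hj, hr⟩ ⟨r', rfl, j', hj', hr'⟩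
        exact ⟨r + r', map_add _ _ _, j + j',
          Submodule.add_mem (J : Submodule (R k) (FractionRing (R k))) hj hj',
          by rw [map_add, hr, hr', mul_add]⟩
      smul_mem' := by
        rintro c _ ⟨r, rfl, j, hj, hr⟩
        refine ⟨algebraMap k (R k) c * r, ?_, ι (algebraMap k (R k) c) * j, hJsmul _ hj, ?_⟩
        · rw [map_mul, algebraMap_algebraMap, PowerSeries.smul_eq_C_mul]
        · rw [map_mul, hr, mul_left_comm] }
  have hgJ : algebraMap (R k) k⟦X⟧ g ∉ J' := by
    rintro ⟨r, hr, j, hj, hrj⟩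
    rw [algebraMap_injective hr, hg] at hrj
    exact hqJ (mul_left_cancel₀ hιa hrj ▸ hj)
  obtain ⟨φ, hφg, hφ⟩ := Submodule.exists_le_ker_of_notMem hgJ
  obtain ⟨N, hN, hφN⟩ : ∃ N, 3 ≤ N ∧ ∀ f, φ (PowerSeries.X ^ N * f) = 0 := by
    -- If `r ∈ J` is nonzero and `a r` has order `n`, then `a J` contains `a r t³ k⟦X⟧ = t^(n+3)
    -- k⟦X⟧`.
    obtain ⟨r, hr, hrJ⟩ := FractionalIdeal.exists_ne_zero_mem_isInteger hJ
    obtain ⟨n, u, hu⟩ := IsDiscreteValuationRing.associated_pow_irreducible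
      ((map_ne_zero_iff _ algebraMap_injective).2 (mul_ne_zero ha hr))
      (PowerSeries.X_irreducible (R := k))
    refine ⟨n + 3, by omega, fun f => ?_⟩
    obtain ⟨s, hs⟩ := exists_algebraMap_eq_X_cube_mul ((u : k⟦X⟧) * f)
    refine hφ ⟨a * r * s, ?_, ι s * ι r, hJsmul s hrJ, ?_⟩
    · rw [map_mul, hs, pow_add, ← hu]
      ring
    · rw [map_mul, map_mul]
      ring
  obtain ⟨H, hH⟩ := exists_coeff_mul_eq φ N hφN
  obtain ⟨n, rfl⟩ : ∃ n, N = n + 2 := ⟨N - 2, by omega⟩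
  -- `H` and `t^n` need not lie in `R`; a factor `t³` brings each into `R` and cancels in the
  -- quotient.
  obtain ⟨s, hs⟩ := exists_algebraMap_eq_X_cube_mul H
  obtain ⟨d, hd⟩ := exists_algebraMap_eq_X_cube_mul (k := k) (PowerSeries.X ^ n)
  have hX : (PowerSeries.X : k⟦X⟧) ≠ 0 := PowerSeries.X_ne_zero
  have hd0 : ι d ≠ 0 := by
    rw [map_ne_zero_iff ι hι]
    rintro rfl
    rw [map_zero, ← pow_add] at hd
    exact pow_ne_zero _ hX hd.symm
  -- multiplication by `a x s / d` takes `r / a` to the element of `R` with series `t ^ (3 - n) H r`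
  have key (r i : R k) (j : FractionRing (R k)) (hr : ι r = ι a * j) :
      ι (a * x k * s) / ι d * j = ι i ↔ H * algebraMap (R k) k⟦X⟧ r * PowerSeries.X ^ 3 =
        PowerSeries.X ^ n * algebraMap (R k) k⟦X⟧ i := by
    have h1 : ι (a * x k * s) / ι d * j = ι i ↔ x k * s * r = i * d := by
      rw [← hι.eq_iff, div_mul_eq_mul_div, div_eq_iff hd0, map_mul, map_mul, map_mul, map_mul,
        map_mul, hr]
      constructor <;> intro h <;> rw [← h] <;> ring
    rw [h1, ← algebraMap_injective.eq_iff, map_mul, map_mul, map_mul, hs, hd, algebraMap_x]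
    constructor
    · intro h
      refine mul_left_cancel₀ (pow_ne_zero 3 hX) ?_
      linear_combination h
    · intro h
      linear_combination PowerSeries.X ^ 3 * h
  have hu : ι (a * x k * s) / ι d ∈
      (I k : FractionalIdeal (R k)⁰ (FractionRing (R k))) / J := by
    rw [FractionalIdeal.mem_div_iff_of_ne_zero hJ]
    intro j hj
    obtain ⟨r, hr⟩ := haJ j hj
    have hφr (f : R k) : φ (algebraMap (R k) k⟦X⟧ f * algebraMap (R k) k⟦X⟧ r) = 0 :=
      hφ ⟨f * r, map_mul _ _ _, ι f * j, hJsmul f hj, by rw [map_mul, hr, mul_left_comm]⟩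
    obtain ⟨κ, hκ⟩ : PowerSeries.X ^ n ∣ H * algebraMap (R k) k⟦X⟧ r := by
      rw [PowerSeries.X_pow_dvd_iff]
      intro m hm
      -- Testing `φ` on `t^(3+l) r` kills the coefficients of `H r` below degree `n`, and testing on
      -- `r` kills degree `n + 2`. Degrees `n` and `n + 1` stay free, matching the gaps 2 and 1 of
      -- the semigroup, so `H r = t^n κ` with `t³ κ` in `I`.
      obtain ⟨l, hl⟩ : ∃ l, n + 2 = m + (3 + l) := ⟨n - m - 1, by omega⟩
      obtain ⟨f, hf⟩ := exists_algebraMap_eq_X_cube_mul (k := k) (PowerSeries.X ^ l)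
      have h := hφr f
      rw [← hH, hf, ← pow_add, mul_left_comm, hl, PowerSeries.coeff_X_pow_mul'] at h
      simpa using h
    have hκ2 : PowerSeries.coeff 2 κ = 0 := by
      have h := hφr 1
      rw [← hH, map_one, one_mul, hκ, PowerSeries.coeff_X_pow_mul'] at h
      simpa using h
    obtain ⟨i, hi⟩ := exists_algebraMap_eq_X_cube_mul κ
    rw [(key r i j hr).2 (by rw [hκ, hi]; ring)]
    exact FractionalIdeal.mem_coeIdeal_of_mem _ ((mem_I_iff i).2 ⟨κ, hκ2, hi⟩)
  have hqu := (FractionalIdeal.mem_div_iff_of_ne_zero hIJ).1 hq _ hu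
  rw [mul_comm, FractionalIdeal.mem_coeIdeal] at hqu
  obtain ⟨i, hi, hiq⟩ := hqu
  obtain ⟨κ, hκ2, hκ⟩ := (mem_I_iff i).1 hi
  have h := (key g i q hg).1 hiq.symm
  rw [hκ, mul_comm (_ ^ n), mul_comm _ (PowerSeries.X ^ 3), mul_assoc] at h
  have h' := mul_left_cancel₀ (pow_ne_zero 3 hX) h
  apply hφg
  rw [← hH, h', mul_comm, PowerSeries.coeff_X_pow_mul']
  simpa using hκ2

theorem isCanonicalIdeal_I : IsCanonicalIdeal (I k) := by
  have hx : x k ∈ I k := Ideal.subset_span (by simp)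
  have hI : I k ≠ ⊥ := fun h => x_ne_zero ((Ideal.mem_bot).1 (h ▸ hx))
  refine ⟨hI, fun J hJ => ?_⟩
  have hIJ : (I k : FractionalIdeal (R k)⁰ (FractionRing (R k))) / J ≠ 0 := by
    obtain ⟨b, hb, hbJ⟩ := J.isFractional
    -- A common denominator `b` of `J`, multiplied by `x ∈ I`, carries `J` into `I`.
    have hmem : algebraMap (R k) (FractionRing (R k)) (x k * b) ∈
        (I k : FractionalIdeal (R k)⁰ (FractionRing (R k))) / J := by
      rw [FractionalIdeal.mem_div_iff_of_ne_zero hJ]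
      intro j hj
      obtain ⟨r, hr⟩ := hbJ j hj
      rw [map_mul, mul_assoc, ← Algebra.smul_def b, ← hr, ← map_mul]
      exact FractionalIdeal.mem_coeIdeal_of_mem _ (Ideal.mul_mem_right _ _ hx)
    intro h
    rw [h, FractionalIdeal.mem_zero_iff, map_eq_zero_iff _ (IsFractionRing.injective _ _)] at hmem
    exact mul_ne_zero x_ne_zero (nonZeroDivisors.ne_zero hb) hmem
  refine le_antisymm (fun q hq => mem_div_div hJ hIJ hq) fun j hj => ?_
  rw [FractionalIdeal.mem_div_iff_of_ne_zero hIJ]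
  intro u hu
  rw [mul_comm]
  exact (FractionalIdeal.mem_div_iff_of_ne_zero hJ).1 hu j hj

end

end Semigroup345

theorem mainTheorem4 (k : Type*) [Field k] :
    IsCanonicalIdeal (I k) ∧
    -- the non-split extension `0 → R → M → I → 0`
    (∃ (s : R k →ₗ[R k] M k) (t : M k →ₗ[R k] I k),
      s 1 = e k 2 ∧
      (t (e k 0) : R k) = x k ∧ (t (e k 1) : R k) = y k ∧ (t (e k 2) : R k) = 0 ∧
      Function.Injective s ∧ Function.Exact s t ∧ Function.Surjective t ∧
      ¬ ∃ u : I k →ₗ[R k] M k, t ∘ₗ u = LinearMap.id) ∧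
    Module.IsTorsionFree (R k) (M k) ∧
    Module.finrank (FractionRing (R k)) (FractionRing (R k) ⊗[R k] M k) = 2 ∧
    (⊤ : Submodule (R k) (M k)).spanFinrank = 3 ∧
    IsIndecomposableModule (R k) (M k) ∧
    Module.IsTorsionFree (R k) (M k ⊗[R k] M k) ∧
    -- the strong self duality and the tensor product over the endomorphism ring
    (∃ α : StrongSelfDuality (R k) (M k) (I k),
      (∀ i j, (α.toEquiv (e k i) (e k j) : R k) = G k i j) ∧
      -- `M` and `M_*` are cyclic over the endomorphism ring
      (∀ m : M k, ∃ f : Module.End (R k) (M k), f • e k 2 = m) ∧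
      (∀ m : α.rStarAlgebra.RightModule (M k), ∃ f : Module.End (R k) (M k),
        MulOpposite.op f • α.rStarAlgebra.toRight (M k) (e k 2) = m) ∧
      -- a nonzero torsion element
      ∃ τ : TensorOver (R k) (Module.End (R k) (M k)) (α.rStarAlgebra.RightModule (M k)) (M k),
        τ = TensorOver.tmul (R k) (Module.End (R k) (M k))
          (α.rStarAlgebra.toRight (M k) (e k 2)) (e k 2) ∧
        τ ≠ 0 ∧ ∃ r ∈ nonZeroDivisors (R k), r • τ = 0) := by
  refine ⟨isCanonicalIdeal_I, exists_extension, inferInstance, finrank_fractionRing_tensor,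
    spanFinrank_top_M, isIndecomposableModule_M, inferInstance, ?_⟩
  obtain ⟨α, hα⟩ := exists_duality (k := k)
  refine ⟨α, fun i j => algebraMap_injective ?_, exists_end_apply_e_two, fun m => ?_, _, rfl,
    tmul_e_two_ne_zero α hα, x k, mem_nonZeroDivisors_of_ne_zero x_ne_zero,
    x_smul_tmul_e_two α hα⟩
  · rw [hα, form_apply]
    fin_cases i <;> fin_cases j <;> simp [G] <;> ring
  · obtain ⟨m, rfl⟩ := (α.rStarAlgebra.toRight (M k)).surjective m
    obtain ⟨f, hf⟩ := exists_end_apply_e_two m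
    refine ⟨α.rStarAlgebra.star f, ?_⟩
    change α.rStarAlgebra.toRight (M k) (α.rStarAlgebra.star (α.rStarAlgebra.star f) (e k 2)) = _
    rw [α.rStarAlgebra.star_star, hf]
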